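/- An mm-space is a triple $(X,d_X,m_X)$, where $(X,d_X)$ is a complete separable metric space and $m_X$ is a Borel probability measure on $X$. Let $I=[0,1)$ with Lebesgue measure $\mathcal L^1$. A parameter of $X$ is a Borel measurable map $\varphi:I\to X$ with $\varphi_*\mathcal L^1=m_X$. Let $\mathcal{L}ip_1(X)$ be the set of all $1$-Lipschitz functions $f:X\to\mathbb R$, and put $\varphi^*\mathcal{L}ip_1(X)=\{f\circ\varphi\mid f\in\mathcal{L}ip_1(X)\}$. For measurable $u,v:I\to\mathbb R$, the Ky Fan distance is $$d_{\mathrm{KF}}(u,v)=\inf\{\varepsilon\ge 0\mid \mathcal L^1(\{s\in I: |u(s)-v(s)|>\varepsilon\})\le\varepsilon\},$$ and $d_{\mathrm H}^{\mathrm{KF}}$ denotes the Hausdorff distance with respect to $d_{\mathrm{KF}}$. The observable distance between two mm-spaces $X$ and $Y$ is $$d_{\mathrm{conc}}(X,Y)=\inf_{\varphi,\psi} d_{\mathrm H}^{\mathrm{KF}}\bigl(\varphi^*\mathcal{L}ip_1(X),\psi^*\mathcal{L}ip_1(Y)\bigr),$$ where $\varphi$ and $\psi$ run over all parameters of $X$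 and of $Y$, respectively. **Theorem.** Let $X$ and $Y$ be two mm-spaces. If $d_{\mathrm{conc}}(X,Y)=0$, then $X$ and $Y$ are mm-isomorphic, that is, there is a bijective isometry $f:\operatorname{supp} m_X\to\operatorname{supp} m_Y$ between the supports of the two measures such that $f_*m_X=m_Y$. -/

import Mathlib

open MeasureTheory
open scoped ENNReal NNReal

noncomputable section

namespace MMSpace

/-- The interval `I = [0, 1)`, with the Borel `σ`-algebra as a subtype of `ℝ`. -/
abbrev UnitIco : Type := Set.Ico (0 : ℝ) 1

/-- The Lebesgue measure on `I = [0, 1)`. -/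
def lebesgueI : Measure UnitIco := Measure.comap Subtype.val (volume : Measure ℝ)

/-- A parameter of `(X, m)`: a Borel map `φ : [0, 1) → X` pushing Lebesgue measure forward
to `m`. -/
def IsParameter {X : Type*} [MeasurableSpace X] (m : Measure X) (φ : UnitIco → X) : Prop :=
  Measurable φ ∧ Measure.map φ lebesgueI = m

/-- The Ky Fan distance: the infimum of all `ε ≥ 0` with `μ {|f - g| > ε} ≤ ε`
(equal to `∞` if there is no such `ε`, which does not happen for finite `μ`). -/
def kyFan {Ω : Type*} [MeasurableSpace Ω] (μ : Measure Ω) (f g : Ω → ℝ) : ℝ≥0∞ :=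
  ⨅ (ε : ℝ≥0) (_ : μ {x | (ε : ℝ) < |f x - g x|} ≤ ε), (ε : ℝ≥0∞)

/-- The Hausdorff distance of two sets with respect to a distance function `d`. -/
def hausdorff {S : Type*} (d : S → S → ℝ≥0∞) (A B : Set S) : ℝ≥0∞ :=
  (⨆ a ∈ A, ⨅ b ∈ B, d a b) ⊔ (⨆ b ∈ B, ⨅ a ∈ A, d b a)

/-- The set of all `1`-Lipschitz functions `X → ℝ`. -/
def lipOne (X : Type*) [PseudoMetricSpace X] : Set (X → ℝ) :=
  {f | LipschitzWith 1 f}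

/-- The pullback `φ^* Lip₁(X) = {f ∘ φ | f ∈ Lip₁(X)}`. -/
def pullbackLipOne {X Ω : Type*} [PseudoMetricSpace X] (φ : Ω → X) : Set (Ω → ℝ) :=
  (fun f : X → ℝ => f ∘ φ) '' lipOne X

/-- The observable distance between `(X, mX)` and `(Y, mY)`. -/
def dconc {X Y : Type*} [PseudoMetricSpace X] [MeasurableSpace X] (mX : Measure X)
    [PseudoMetricSpace Y] [MeasurableSpace Y] (mY : Measure Y) : ℝ≥0∞ :=
  ⨅ (φ : UnitIco → X) (_ : IsParameter mX φ) (ψ : UnitIco → Y) (_ : IsParameter mY ψ),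
    hausdorff (kyFan lebesgueI) (pullbackLipOne φ) (pullbackLipOne ψ)

/-- `(X, mX)` and `(Y, mY)` are mm-isomorphic: there is a (bijective) isometry between the supports
of the measures which pushes `mX`, as a measure on its support, forward to `mY`, as a measure
on its support. -/
def MMIsomorphic {X Y : Type*} [PseudoMetricSpace X] [MeasurableSpace X] (mX : Measure X)
    [PseudoMetricSpace Y] [MeasurableSpace Y] (mY : Measure Y) : Prop :=
  ∃ f : mX.support ≃ᵢ mY.support,
    Measure.map f (mX.comap Subtype.val) = mY.comap Subtype.val

end MMSpace

end

noncomputable section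

namespace MMSpace

open Filter Topology Set

/-! ### Rigidity of mutual 1-Lipschitz domination -/

section Rigidity

/-! Vanishing observable distance makes each space a 1-Lipschitz image of the other, and mutual
domination is rigid.

Domination. Let `x i` be dense in `X`. For each `n` some parameters bring every function `dist (x i)
·` within `δ n → 0` of a 1-Lipschitz function `g n i` on `Y`. The parameters vary with `n` and need
not converge, but the laws do not depend on them. Along a subsequence `g n i → G i` pointwise, so
the family `G` has under `mY` the joint law of the distance functions under `mX`
(`exists_lipschitz_map_eq`). The distance functions embed `X` in `ι → ℝ`; inverting this embedding
on the values of `G` gives a measure-preserving 1-Lipschitz map from the support of `mY` to that of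
`mX` (`exists_lipschitzWith_measurePreserving`).

Rigidity. By symmetry there are such maps in both directions. Neither can increase the mean of
`arctan (dist x y)`, so the means agree and no distance shrinks (`isometry_of_lipschitzWith_one`).
The arctangent makes the integrand bounded, hence integrable, and its strict monotonicity loses no
information. -/

lemma integrable_arctan {Ω : Type*} [MeasurableSpace Ω] [TopologicalSpace Ω]
    [OpensMeasurableSpace Ω] (μ : Measure Ω) [IsFiniteMeasure μ] {d : Ω → ℝ} (hd : Continuous d) :
    Integrable (fun z => Real.arctan (d z)) μ := by
  refine Integrable.of_bound (Real.continuous_arctan.comp hd).measurable.aestronglyMeasurable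
    (Real.pi / 2) (ae_of_all _ fun z => ?_)
  rw [Real.norm_eq_abs, abs_le]
  exact ⟨(Real.neg_pi_div_two_lt_arctan _).le, (Real.arctan_lt_pi_div_two _).le⟩

variable {A B : Type*} [MetricSpace A] [SecondCountableTopology A] [MeasurableSpace A]
  [BorelSpace A] [MetricSpace B] [SecondCountableTopology B] [MeasurableSpace B] [BorelSpace B]

lemma integral_arctan_dist_comp {A B : Type*} [MeasurableSpace A] [MetricSpace A] [MetricSpace B]
    [SecondCountableTopology B] [MeasurableSpace B] [BorelSpace B] {μ : Measure A} {ν : Measure B} [IsFiniteMeasure μ]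
    [IsFiniteMeasure ν] {p : A → B} (hμ : MeasurePreserving p μ ν) :
    ∫ z : A × A, Real.arctan (dist (p z.1) (p z.2)) ∂(μ.prod μ)
      = ∫ z : B × B, Real.arctan (dist z.1 z.2) ∂(ν.prod ν) := by
  have hpp := hμ.prod hμ
  rw [← hpp.map_eq, integral_map hpp.measurable.aemeasurable]
  · rfl
  · rw [hpp.map_eq]
    exact (integrable_arctan (ν.prod ν) continuous_dist).aestronglyMeasurable

lemma integral_arctan_dist_le {μ : Measure A} {ν : Measure B} [IsFiniteMeasure μ]
    [IsFiniteMeasure ν] {p : A → B} (hp : LipschitzWith 1 p) (hμ : MeasurePreserving p μ ν) :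
    ∫ z : B × B, Real.arctan (dist z.1 z.2) ∂(ν.prod ν)
      ≤ ∫ z : A × A, Real.arctan (dist z.1 z.2) ∂(μ.prod μ) := by
  rw [← integral_arctan_dist_comp hμ]
  have hint : Integrable (fun z : A × A => Real.arctan (dist (p z.1) (p z.2))) (μ.prod μ) :=
    integrable_arctan (μ.prod μ)
      ((hp.continuous.comp continuous_fst).dist (hp.continuous.comp continuous_snd))
  have hint' : Integrable (fun z : A × A => Real.arctan (dist z.1 z.2)) (μ.prod μ) :=
    integrable_arctan (μ.prod μ) continuous_dist
  refine integral_mono hint hint' fun z => Real.arctan_strictMono.monotone ?_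
  simpa using hp.dist_le_mul z.1 z.2

/-- A measure-preserving `1`-Lipschitz map is an isometry as soon as there is one in the opposite
direction. -/
lemma isometry_of_lipschitzWith_one {μ : Measure A} {ν : Measure B} [IsFiniteMeasure μ]
    [IsFiniteMeasure ν] [μ.IsOpenPosMeasure] {p : A → B} {q : B → A}
    (hp : LipschitzWith 1 p) (hpm : MeasurePreserving p μ ν)
    (hq : LipschitzWith 1 q) (hqm : MeasurePreserving q ν μ) : Isometry p := by
  have hpc := hp.continuous
  have hle : ∀ z : A × A, dist (p z.1) (p z.2) ≤ dist z.1 z.2 := fun z => by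
    simpa using hp.dist_le_mul z.1 z.2
  have hint : Integrable (fun z : A × A => Real.arctan (dist (p z.1) (p z.2))) (μ.prod μ) :=
    integrable_arctan (μ.prod μ) ((hpc.comp continuous_fst).dist (hpc.comp continuous_snd))
  have hint' : Integrable (fun z : A × A => Real.arctan (dist z.1 z.2)) (μ.prod μ) :=
    integrable_arctan (μ.prod μ) continuous_dist
  have heq : ∫ z : A × A, (Real.arctan (dist z.1 z.2) - Real.arctan (dist (p z.1) (p z.2)))
      ∂(μ.prod μ) = 0 := by
    rw [integral_sub hint' hint, integral_arctan_dist_comp hpm, sub_eq_zero]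
    exact (integral_arctan_dist_le hq hqm).antisymm (integral_arctan_dist_le hp hpm)
  rw [integral_eq_zero_iff_of_nonneg
    (fun z => sub_nonneg.2 (Real.arctan_strictMono.monotone (hle z))) (hint'.sub hint)] at heq
  have hcont : Continuous fun z : A × A =>
      Real.arctan (dist z.1 z.2) - Real.arctan (dist (p z.1) (p z.2)) := by fun_prop
  -- The product measure charges every nonempty open set, so a continuous function vanishing a.e.
  -- vanishes everywhere.
  have hzero := (Continuous.ae_eq_iff_eq (μ.prod μ) hcont continuous_zero).1 heq
  refine Isometry.of_dist_eq fun x y => ?_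
  have := congrFun hzero (x, y)
  exact (Real.arctan_injective (sub_eq_zero.1 this)).symm

/-- By completeness the range is closed; its complement is open and null, hence empty. -/
lemma surjective_of_isometry {A B : Type*} [MetricSpace A] [CompleteSpace A] [MeasurableSpace A]
    [MetricSpace B] [MeasurableSpace B] [BorelSpace B] {μ : Measure A} {ν : Measure B}
    [ν.IsOpenPosMeasure] {p : A → B} (hp : Isometry p) (hpm : MeasurePreserving p μ ν) :
    Function.Surjective p := by
  have hcl : IsClosed (range p) := hp.isClosedEmbedding.isClosed_range
  have hz : ν (range p)ᶜ = 0 := by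
    rw [← hpm.measure_preimage hcl.measurableSet.compl.nullMeasurableSet]
    have : p ⁻¹' (range p)ᶜ = ∅ := by ext; simp
    rw [this, measure_empty]
  rw [hcl.isOpen_compl.measure_eq_zero_iff (μ := ν), compl_empty_iff] at hz
  exact range_eq_univ.1 hz

end Rigidity

/-! ### Measures restricted to their supports -/

section Support

variable {X : Type*} [MetricSpace X] [SecondCountableTopology X] [MeasurableSpace X]
  [BorelSpace X] (m : Measure X)

lemma measurableEmbedding_support_val {X : Type*} [TopologicalSpace X] [MeasurableSpace X]
    [OpensMeasurableSpace X] (m : Measure X) :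
    MeasurableEmbedding (Subtype.val : m.support → X) :=
  MeasurableEmbedding.subtype_coe m.isClosed_support.measurableSet

/-- The restriction of a measure to its support. -/
abbrev onSupport : Measure m.support := m.comap Subtype.val

lemma map_val_onSupport : (onSupport m).map Subtype.val = m := by
  rw [onSupport, (measurableEmbedding_support_val m).map_comap, Subtype.range_coe]
  exact Measure.restrict_eq_self_of_ae_mem Measure.support_mem_ae

instance [IsFiniteMeasure m] : IsFiniteMeasure (onSupport m) :=
  ⟨by rw [(measurableEmbedding_support_val m).comap_apply]; exact measure_lt_top _ _⟩

instance : (onSupport m).IsOpenPosMeasure where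
  open_pos U hU hne := by
    obtain ⟨V, hV, rfl⟩ := isOpen_induced_iff.1 hU
    obtain ⟨x, hx⟩ := hne
    have h := (Measure.mem_support_iff_forall _).1 x.2 V (hV.mem_nhds hx)
    rw [← map_val_onSupport m, Measure.map_apply measurable_subtype_coe hV.measurableSet] at h
    exact h.ne'

end Support

/-- If the support of each of two measures is mapped onto the other one by a measure-preserving
`1`-Lipschitz map, then the two spaces are isomorphic. -/
lemma mmIsomorphic_of_lipschitzWith_one {X Y : Type*}
    [MetricSpace X] [CompleteSpace X] [SecondCountableTopology X] [MeasurableSpace X]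
    [BorelSpace X] {mX : Measure X} [IsFiniteMeasure mX]
    [MetricSpace Y] [SecondCountableTopology Y] [MeasurableSpace Y]
    [BorelSpace Y] {mY : Measure Y} [IsFiniteMeasure mY]
    {p : mX.support → mY.support} {q : mY.support → mX.support}
    (hp : LipschitzWith 1 p) (hpm : MeasurePreserving p (onSupport mX) (onSupport mY))
    (hq : LipschitzWith 1 q) (hqm : MeasurePreserving q (onSupport mY) (onSupport mX)) :
    MMIsomorphic mX mY := by
  have : CompleteSpace mX.support := mX.isClosed_support.completeSpace_coe
  have hiso := isometry_of_lipschitzWith_one hp hpm hq hqm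
  exact ⟨⟨Equiv.ofBijective p ⟨hiso.injective, surjective_of_isometry hiso hpm⟩, hiso⟩, hpm.map_eq⟩

/-! ### From equal joint laws to a 1-Lipschitz map -/

section Factor

/-- The bound extends by continuity from the dense points to the point `a` itself, where the left
side is `dist a b`. -/
lemma dist_le_of_forall_dist_denseRange {X ι : Type*} [PseudoMetricSpace X] {x : ι → X} (hx : DenseRange x) {a b : X} {r : ℝ}
    (h : ∀ i, |dist (x i) a - dist (x i) b| ≤ r) : dist a b ≤ r := by
  have hcl : IsClosed {z | |dist z a - dist z b| ≤ r} :=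
    isClosed_le (by fun_prop) continuous_const
  have : a ∈ {z | |dist z a - dist z b| ≤ r} :=
    (closure_minimal (range_subset_iff.2 h) hcl) (hx a)
  simpa using this

variable {X Y ι : Type*} [Countable ι]
    [MetricSpace X] [CompleteSpace X] [SecondCountableTopology X] [MeasurableSpace X]
    [BorelSpace X] {mX : Measure X}
    [MetricSpace Y] [SecondCountableTopology Y] [MeasurableSpace Y]
    [BorelSpace Y] {mY : Measure Y}

/-- If the joint law of the distances to a dense sequence in `X` is the joint law of some
`1`-Lipschitz functions on `Y`, then the support of `mY` is mapped to the support of `mX` by a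
measure-preserving `1`-Lipschitz map. -/
lemma exists_lipschitzWith_measurePreserving {x : ι → X} (hx : DenseRange x) {g : ι → Y → ℝ}
    (hg : ∀ i, LipschitzWith 1 (g i))
    (hlaw : mX.map (fun a i => dist (x i) a) = mY.map (fun y i => g i y)) :
    ∃ p : mY.support → mX.support, LipschitzWith 1 p ∧
      MeasurePreserving p (onSupport mY) (onSupport mX) := by
  set F : X → ι → ℝ := fun a i => dist (x i) a
  set G : Y → ι → ℝ := fun y i => g i y
  have hFc : Continuous F := by fun_prop
  have hGc : Continuous G := continuous_pi fun i => (hg i).continuous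
  have hFinj : Function.Injective F := fun a b hab => by
    refine dist_le_zero.1 (dist_le_of_forall_dist_denseRange hx fun i => ?_)
    have : dist (x i) a = dist (x i) b := congrFun hab i
    simp [this]
  have hFe : MeasurableEmbedding F := hFc.measurableEmbedding hFinj
  have hdist : ∀ {y y' : Y} {a a' : X}, F a = G y → F a' = G y' → dist a a' ≤ dist y y' := by
    intro y y' a a' h h'
    refine dist_le_of_forall_dist_denseRange hx fun i => ?_
    have e : dist (x i) a = g i y := congrFun h i
    have e' : dist (x i) a' = g i y' := congrFun h' i
    rw [e, e', ← Real.dist_eq]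
    simpa using (hg i).dist_le_mul y y'
  -- If `u n → y` and `F (a n) = G (u n)`, then `hdist` makes `a` Cauchy, and completeness of `X`
  -- supplies a preimage of `G y`.
  have hcl : IsClosed (G ⁻¹' range F) := by
    refine IsSeqClosed.isClosed fun u y hu huy => ?_
    choose a ha using hu
    have hcau : CauchySeq a := by
      rw [Metric.cauchySeq_iff]
      intro ε hε
      obtain ⟨N, hN⟩ := Metric.cauchySeq_iff.1 huy.cauchySeq ε hε
      exact ⟨N, fun m hm n hn => (hdist (ha m) (ha n)).trans_lt (hN m hm n hn)⟩
    obtain ⟨b, hb⟩ := cauchySeq_tendsto_of_complete hcau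
    refine ⟨b, tendsto_nhds_unique ((hFc.tendsto b).comp hb) ?_⟩
    exact ((hGc.tendsto y).comp huy).congr fun n => (ha n).symm
  have hsub : mY.support ⊆ G ⁻¹' range F := by
    refine Measure.support_subset_of_isClosed hcl ?_
    rw [mem_ae_iff, ← preimage_compl,
      ← Measure.map_apply hGc.measurable hFe.measurableSet_range.compl, ← hlaw,
      Measure.map_apply hFc.measurable hFe.measurableSet_range.compl]
    have : F ⁻¹' (range F)ᶜ = ∅ := by ext; simp
    rw [this, measure_empty]
  choose p hp using fun y : mY.support => hsub y.2
  have hpl : LipschitzWith 1 p := LipschitzWith.of_dist_le_mul fun y y' => by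
    simpa [Subtype.dist_eq] using hdist (hp y) (hp y')
  have hpm : (onSupport mY).map p = mX := by
    -- Since `F` is a measurable embedding, measures on `X` can be compared after pushing forward by
    -- `F`, where `F ∘ p = G`.
    have h1 : ((onSupport mY).map p).map F = mX.map F := by
      rw [hlaw, Measure.map_map hFc.measurable hpl.continuous.measurable]
      conv_rhs => rw [← map_val_onSupport mY]
      rw [Measure.map_map hGc.measurable measurable_subtype_coe]
      congr 1
      exact funext hp
    rw [← hFe.comap_map ((onSupport mY).map p), h1, hFe.comap_map]
  have hps : ∀ y, p y ∈ mX.support := by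
    have hcl' : IsClosed (p ⁻¹' mX.support) := mX.isClosed_support.preimage hpl.continuous
    have hz : onSupport mY (p ⁻¹' mX.support)ᶜ = 0 := by
      rw [← preimage_compl, ← Measure.map_apply hpl.continuous.measurable
        mX.isClosed_support.measurableSet.compl, hpm]
      exact Measure.measure_compl_support
    rw [hcl'.isOpen_compl.measure_eq_zero_iff (μ := onSupport mY), compl_empty_iff] at hz
    exact fun y => (hz ▸ mem_univ y : y ∈ p ⁻¹' mX.support)
  have hps_meas : Measurable fun y => (⟨p y, hps y⟩ : mX.support) :=
    hpl.continuous.measurable.subtype_mk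
  refine ⟨fun y => ⟨p y, hps y⟩, hpl, hps_meas, ?_⟩
  have he := measurableEmbedding_support_val mX
  rw [← he.comap_map ((onSupport mY).map _), Measure.map_map measurable_subtype_coe hps_meas]
  change ((onSupport mY).map p).comap _ = _
  rw [hpm]

end Factor

/-! ### Compactness of 1-Lipschitz families -/

section LipschitzLimits

variable {Y ι : Type*} [PseudoMetricSpace Y]

/-- A family of `1`-Lipschitz sequences that are bounded at a point has pointwise limits along a
common subsequence. -/
lemma exists_subseq_tendsto_lipschitz [Countable ι] [TopologicalSpace.SeparableSpace Y]
    {g : ℕ → ι → Y → ℝ} (hg : ∀ n i, LipschitzWith 1 (g n i)) (y₀ : Y) {C : ι → ℝ}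
    (hC : ∀ n i, |g n i y₀| ≤ C i) :
    ∃ (k : ℕ → ℕ) (G : ι → Y → ℝ), StrictMono k ∧ (∀ i, LipschitzWith 1 (G i)) ∧
      ∀ i y, Tendsto (fun n => g (k n) i y) atTop (𝓝 (G i y)) := by
  obtain ⟨s, hs, hsd⟩ := TopologicalSpace.exists_countable_dense Y
  have : Countable s := hs.to_subtype
  -- Tychonoff on the countably many pairs (index, dense point) replaces a diagonal argument.
  have hK : IsCompact (Set.pi univ fun z : ι × s =>
      Icc (-(C z.1 + dist (z.2 : Y) y₀)) (C z.1 + dist (z.2 : Y) y₀)) :=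
    isCompact_univ_pi fun z => isCompact_Icc
  have hmem : ∀ n, (fun z : ι × s => g n z.1 z.2) ∈ Set.pi univ fun z : ι × s =>
      Icc (-(C z.1 + dist (z.2 : Y) y₀)) (C z.1 + dist (z.2 : Y) y₀) := by
    intro n z _
    have h1 : |g n z.1 z.2 - g n z.1 y₀| ≤ dist (z.2 : Y) y₀ := by
      rw [← Real.dist_eq]; simpa using (hg n z.1).dist_le_mul z.2 y₀
    have h2 := hC n z.1
    rw [abs_le] at h1 h2
    exact ⟨by linarith [h1.1, h2.1], by linarith [h1.2, h2.2]⟩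
  obtain ⟨v, -, k, hk, hv⟩ := hK.tendsto_subseq hmem
  rw [tendsto_pi_nhds] at hv
  have hcau : ∀ i y, ∃ c, Tendsto (fun n => g (k n) i y) atTop (𝓝 c) := by
    intro i y
    refine cauchySeq_tendsto_of_complete (Metric.cauchySeq_iff'.2 fun ε hε => ?_)
    obtain ⟨d, hds, hd⟩ := hsd.exists_dist_lt y (show 0 < ε / 3 by positivity)
    have hcs := (hv (i, ⟨d, hds⟩)).cauchySeq
    obtain ⟨N, hN⟩ := Metric.cauchySeq_iff'.1 hcs (ε / 3) (by positivity)
    refine ⟨N, fun n hn => ?_⟩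
    have h1 : dist (g (k n) i d) (g (k N) i d) < ε / 3 := hN n hn
    have h2 : dist (g (k n) i y) (g (k n) i d) ≤ dist y d := by
      simpa using (hg (k n) i).dist_le_mul y d
    have h3 : dist (g (k N) i d) (g (k N) i y) ≤ dist y d := by
      simpa [dist_comm] using (hg (k N) i).dist_le_mul d y
    linarith [dist_triangle4 (g (k n) i y) (g (k n) i d) (g (k N) i d) (g (k N) i y)]
  choose G hG using hcau
  refine ⟨k, G, hk, fun i => LipschitzWith.of_dist_le_mul fun y y' => ?_, hG⟩
  exact le_of_tendsto ((hG i y).dist (hG i y')) (Eventually.of_forall fun n =>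
    (hg (k n) i).dist_le_mul y y')

end LipschitzLimits

/-! ### Limits of joint laws -/

section Laws

variable {Ω X Y ι : Type*} [MeasurableSpace Ω] {P : Measure Ω} [IsProbabilityMeasure P]
  [MeasurableSpace X] {mX : Measure X} [MeasurableSpace Y] {mY : Measure Y}

lemma exists_measure_lt_of_measurable {f : X → ℝ} [IsFiniteMeasure mX] (hf : Measurable f)
    {ε : ℝ≥0∞} (hε : 0 < ε) : ∃ R : ℝ, mX {x | R < f x} < ε := by
  have h := tendsto_measure_iInter_atTop (μ := mX) (s := fun n : ℕ => {x | (n : ℝ) < f x})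
    (fun n => (measurableSet_lt measurable_const hf).nullMeasurableSet)
    (fun m n hmn x (hx : (n : ℝ) < f x) => (lt_of_le_of_lt (Nat.cast_le.2 hmn) hx : (m : ℝ) < f x)) ⟨0, measure_ne_top _ _⟩
  have he : ⋂ n : ℕ, {x | (n : ℝ) < f x} = ∅ := by
    ext x
    obtain ⟨n, hn⟩ := exists_nat_ge (f x)
    simpa using ⟨n, hn⟩
  rw [he, measure_empty] at h
  obtain ⟨n, hn⟩ := (h.eventually_lt_const hε).exists
  exact ⟨n, hn⟩

lemma tendstoInMeasure_pi_of_measure_lt {Ω ι : Type*} [MeasurableSpace Ω] {P : Measure Ω}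
    [Fintype ι] {u v : ℕ → Ω → ι → ℝ} {δ : ℕ → ℝ≥0}
    (hδ : Tendsto δ atTop (𝓝 0))
    (h : ∀ n i, P {s | (δ n : ℝ) < |u n s i - v n s i|} ≤ δ n) :
    TendstoInMeasure P (v - u) atTop 0 := by
  rw [tendstoInMeasure_iff_norm]
  intro ε hε
  have hlim : Tendsto (fun n => (Fintype.card ι : ℝ≥0∞) * (δ n : ℝ≥0∞)) atTop (𝓝 0) := by
    have : Tendsto (fun n => (δ n : ℝ≥0∞)) atTop (𝓝 0) := by
      exact ENNReal.tendsto_coe.2 hδ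
    simpa using ENNReal.Tendsto.const_mul this (Or.inr (ENNReal.natCast_ne_top (Fintype.card ι)))
  refine tendsto_of_tendsto_of_tendsto_of_le_of_le' tendsto_const_nhds hlim
    (Eventually.of_forall fun _ => zero_le) ?_
  have hδ' : ∀ᶠ n in atTop, (δ n : ℝ) < ε := by
    have : Tendsto (fun n => (δ n : ℝ)) atTop (𝓝 0) := by
      exact NNReal.tendsto_coe.2 hδ
    exact this.eventually_lt_const hε
  filter_upwards [hδ'] with n hn
  have hsub : {s | ε ≤ ‖(v - u) n s - (0 : ℕ → Ω → ι → ℝ) n s‖} ⊆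
      ⋃ i, {s | (δ n : ℝ) < |u n s i - v n s i|} := by
    intro s hs
    by_contra hcon
    simp only [mem_iUnion, mem_ofPred_eq, not_exists, not_lt] at hcon
    have : ‖(v - u) n s‖ ≤ δ n := (pi_norm_le_iff_of_nonneg (δ n).2).2 fun i => by
      simpa [abs_sub_comm] using hcon i
    simp only [mem_ofPred_eq, Pi.zero_apply, sub_zero] at hs
    linarith
  refine (measure_mono hsub).trans ((measure_iUnion_fintype_le _ _).trans ?_)
  refine (Finset.sum_le_sum fun i _ => h n i).trans ?_
  simp

/-- Two finite-dimensional random vectors whose realizations on a common probability space are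
asymptotically close in probability have the same law. -/
lemma map_eq_map_of_close_fintype [Fintype ι] [IsProbabilityMeasure mX] [IsProbabilityMeasure mY]
    {φ : ℕ → Ω → X} {ψ : ℕ → Ω → Y} (hφ : ∀ n, MeasurePreserving (φ n) P mX)
    (hψ : ∀ n, MeasurePreserving (ψ n) P mY) {f : ι → X → ℝ} (hf : ∀ i, Measurable (f i))
    {g : ℕ → ι → Y → ℝ} (hg : ∀ n i, Measurable (g n i)) {G : ι → Y → ℝ}
    (hG : ∀ i y, Tendsto (fun n => g n i y) atTop (𝓝 (G i y))) {δ : ℕ → ℝ≥0}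
    (hδ : Tendsto δ atTop (𝓝 0))
    (h : ∀ n i, P {s | (δ n : ℝ) < |f i (φ n s) - g n i (ψ n s)|} ≤ δ n) :
    mX.map (fun x i => f i x) = mY.map (fun y i => G i y) := by
  have hF : Measurable fun x i => f i x := measurable_pi_lambda _ hf
  have hgm : ∀ n, Measurable fun y i => g n i y := fun n => measurable_pi_lambda _ (hg n)
  have hlim : ∀ y, Tendsto (fun n => (fun i => g n i y)) atTop (𝓝 fun i => G i y) := fun y =>
    tendsto_pi_nhds.2 fun i => hG i y
  have hGm : Measurable fun y i => G i y :=
    measurable_of_tendsto_metrizable hgm (tendsto_pi_nhds.2 hlim)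
  have hX : TendstoInDistribution (fun n s i => f i (φ n s)) atTop (fun x i => f i x)
      (fun _ => P) mX := by
    refine ⟨fun n => (hF.comp (hφ n).measurable).aemeasurable, hF.aemeasurable, ?_⟩
    refine tendsto_const_nhds.congr fun n => Subtype.ext ?_
    change mX.map _ = P.map _
    rw [← (hφ n).map_eq, Measure.map_map hF (hφ n).measurable]
    rfl
  have hY := tendstoInDistribution_of_tendstoInMeasure_sub (fun n s i => g n i (ψ n s)) _ hX
    (tendstoInMeasure_pi_of_measure_lt hδ h)
    fun n => ((hgm n).comp (hψ n).measurable).aemeasurable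
  -- Here the parameters drop out: `g n ∘ ψ n` under `P` has the law of `g n` under `mY`.
  have hY' : TendstoInDistribution (fun n y i => g n i y) atTop (fun x i => f i x)
      (fun _ => mY) mX := by
    refine ⟨fun n => (hgm n).aemeasurable, hF.aemeasurable, ?_⟩
    refine hY.tendsto.congr fun n => Subtype.ext ?_
    change P.map _ = mY.map _
    rw [← (hψ n).map_eq, Measure.map_map (hgm n) (hψ n).measurable]
    rfl
  have hY'' : TendstoInDistribution (fun n y i => g n i y) atTop (fun y i => G i y)
      (fun _ => mY) mY :=
    TendstoInMeasure.tendstoInDistribution_of_aemeasurable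
      (tendstoInMeasure_of_tendsto_ae (fun n => (hgm n).aestronglyMeasurable)
        (ae_of_all _ hlim)) (fun n => (hgm n).aemeasurable) hGm.aemeasurable
  exact tendstoInDistribution_unique _ hY' hY''

/-- A finite measure on a product is determined by its finite-dimensional marginals, which reduces
the claim to finite index sets. -/
lemma map_eq_map_of_close [IsProbabilityMeasure mX] [IsProbabilityMeasure mY]
    {φ : ℕ → Ω → X} {ψ : ℕ → Ω → Y} (hφ : ∀ n, MeasurePreserving (φ n) P mX)
    (hψ : ∀ n, MeasurePreserving (ψ n) P mY) {f : ι → X → ℝ} (hf : ∀ i, Measurable (f i))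
    {g : ℕ → ι → Y → ℝ} (hg : ∀ n i, Measurable (g n i)) {G : ι → Y → ℝ}
    (hG : ∀ i y, Tendsto (fun n => g n i y) atTop (𝓝 (G i y))) {δ : ℕ → ℝ≥0}
    (hδ : Tendsto δ atTop (𝓝 0))
    (h : ∀ n i, P {s | (δ n : ℝ) < |f i (φ n s) - g n i (ψ n s)|} ≤ δ n) :
    mX.map (fun x i => f i x) = mY.map (fun y i => G i y) := by
  have hF : Measurable fun x i => f i x := measurable_pi_lambda _ hf
  have hGm : Measurable fun y i => G i y := measurable_pi_lambda _ fun i =>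
    measurable_of_tendsto_metrizable (fun n => hg n i) (tendsto_pi_nhds.2 (hG i))
  refine IsProjectiveLimit.unique
    (P := fun I : Finset ι => (mX.map (fun x i => f i x)).map I.restrict)
    (fun I => rfl) (fun I => ?_)
  dsimp only
  rw [Measure.map_map (Finset.measurable_restrict I) hGm,
    Measure.map_map (Finset.measurable_restrict I) hF]
  exact (map_eq_map_of_close_fintype hφ hψ (f := fun i : I => f i) (fun i => hf i)
    (g := fun n (i : I) => g n i) (fun n i => hg n i) (fun i y => hG i y) hδ
    (fun n i => h n i)).symm

end Laws

/-! ### Uniform bounds and passage from the observable distance to laws -/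

section Domination

variable {Ω X Y ι : Type*} [MeasurableSpace Ω] {P : Measure Ω} [IsProbabilityMeasure P]
  [MeasurableSpace X] {mX : Measure X} [IsProbabilityMeasure mX]
  [PseudoMetricSpace Y] [MeasurableSpace Y] [OpensMeasurableSpace Y] {mY : Measure Y}
  [IsProbabilityMeasure mY]

/-- `1`-Lipschitz functions whose laws are close to a given one are bounded at each point. -/
lemma exists_abs_le_of_close {f : X → ℝ} (hf : Measurable f) (y₀ : Y) :
    ∃ C : ℝ, ∀ (φ : Ω → X) (ψ : Ω → Y) (g : Y → ℝ) (δ : ℝ≥0), MeasurePreserving φ P mX →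
      MeasurePreserving ψ P mY → LipschitzWith 1 g → δ ≤ 4⁻¹ →
      P {s | (δ : ℝ) < |f (φ s) - g (ψ s)|} ≤ δ → |g y₀| ≤ C := by
  have h4 : (0 : ℝ≥0∞) < 4⁻¹ := by simp
  obtain ⟨R, hR⟩ := exists_measure_lt_of_measurable (mX := mX) (f := fun x => |f x|) (by fun_prop) h4
  obtain ⟨S, hS⟩ := exists_measure_lt_of_measurable (mX := mY) (f := fun y => dist y y₀)
    (by fun_prop) h4
  refine ⟨R + S + 1, fun φ ψ g δ hφ hψ hg hδ h => ?_⟩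
  have h1 : P {s | R < |f (φ s)|} < 4⁻¹ := by
    rwa [← hφ.measure_preimage (measurableSet_lt measurable_const (by fun_prop)).nullMeasurableSet]
      at hR
  have h2 : P {s | S < dist (ψ s) y₀} < 4⁻¹ := by
    rwa [← hψ.measure_preimage (measurableSet_lt measurable_const (by fun_prop)).nullMeasurableSet]
      at hS
  have h3 : P {s | (δ : ℝ) < |f (φ s) - g (ψ s)|} ≤ 4⁻¹ := h.trans (by
    rw [← ENNReal.coe_le_coe] at hδ; simpa using hδ)
  -- Three exceptional sets of measure at most 1/4 cannot cover `Ω`; a sample point outside them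
  -- bounds `g y₀`.
  have hlt : P ({s | R < |f (φ s)|} ∪ {s | S < dist (ψ s) y₀} ∪
      {s | (δ : ℝ) < |f (φ s) - g (ψ s)|}) < 1 := by
    calc _ ≤ P {s | R < |f (φ s)|} + P {s | S < dist (ψ s) y₀}
          + P {s | (δ : ℝ) < |f (φ s) - g (ψ s)|} :=
          (measure_union_le _ _).trans (add_le_add_left (measure_union_le _ _) _)
      _ ≤ 4⁻¹ + 4⁻¹ + 4⁻¹ := add_le_add (add_le_add h1.le h2.le) h3
      _ < 1 := by
        rw [← ENNReal.toReal_lt_toReal (by simp) (by simp)]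
        rw [ENNReal.toReal_add (by simp) (by simp), ENNReal.toReal_add (by simp) (by simp)]
        norm_num
  have hne : ({s | R < |f (φ s)|} ∪ {s | S < dist (ψ s) y₀} ∪
      {s | (δ : ℝ) < |f (φ s) - g (ψ s)|}) ≠ univ := fun he => by
    rw [he, measure_univ] at hlt
    exact lt_irrefl _ hlt
  obtain ⟨s, hs⟩ := (ne_univ_iff_exists_notMem _).1 hne
  simp only [mem_union, mem_ofPred_eq, not_or, not_lt] at hs
  obtain ⟨⟨ha, hb⟩, hc⟩ := hs
  have hd : |g (ψ s) - g y₀| ≤ dist (ψ s) y₀ := by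
    rw [← Real.dist_eq]; simpa using hg.dist_le_mul (ψ s) y₀
  have hδ' : (δ : ℝ) ≤ 4⁻¹ := by exact_mod_cast hδ
  rw [abs_le] at *
  constructor <;> linarith [ha.1, ha.2, hc.1, hc.2, hd.1, hd.2]

end Domination

lemma measure_le_of_kyFan_lt {Ω : Type*} [MeasurableSpace Ω] {μ : Measure Ω} {u v : Ω → ℝ}
    {δ : ℝ≥0} (h : kyFan μ u v < δ) : μ {x | (δ : ℝ) < |u x - v x|} ≤ δ := by
  simp only [kyFan, iInf_lt_iff] at h
  obtain ⟨ε, hε, hlt⟩ := h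
  have hle : ε ≤ δ := (ENNReal.coe_lt_coe.1 hlt).le
  refine (measure_mono fun x hx => ?_).trans (hε.trans (ENNReal.coe_le_coe.2 hle))
  exact lt_of_le_of_lt (NNReal.coe_le_coe.2 hle) hx

lemma exists_lt_of_hausdorff_lt {S : Type*} {d : S → S → ℝ≥0∞} {A B : Set S} {r : ℝ≥0∞}
    (h : hausdorff d A B < r) {a : S} (ha : a ∈ A) : ∃ b ∈ B, d a b < r := by
  have h1 : ⨅ b ∈ B, d a b < r :=
    (le_iSup₂ (f := fun a (_ : a ∈ A) => ⨅ b ∈ B, d a b) a ha).trans_lt (le_sup_left.trans_lt h)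
  simpa only [iInf_lt_iff, exists_prop] using h1

lemma hausdorff_comm {S : Type*} (d : S → S → ℝ≥0∞) (A B : Set S) :
    hausdorff d A B = hausdorff d B A := sup_comm _ _

lemma isProbabilityMeasure_of_measurePreserving {Ω X : Type*} [MeasurableSpace Ω]
    [MeasurableSpace X] {P : Measure Ω} {m : Measure X} [IsProbabilityMeasure m] {φ : Ω → X}
    (h : MeasurePreserving φ P m) : IsProbabilityMeasure P :=
  ⟨by rw [← measure_univ (μ := m), ← h.measure_preimage MeasurableSet.univ.nullMeasurableSet,
    preimage_univ]⟩

lemma dconc_comm {X Y : Type*} [PseudoMetricSpace X] [MeasurableSpace X] (mX : Measure X)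
    [PseudoMetricSpace Y] [MeasurableSpace Y] (mY : Measure Y) : dconc mX mY = dconc mY mX := by
  refine le_antisymm ?_ ?_ <;>
  · refine le_iInf₂ fun φ hφ => le_iInf₂ fun ψ hψ => ?_
    rw [hausdorff_comm]
    exact iInf₂_le_of_le ψ hψ (iInf₂_le φ hφ)

/-- If the observable distance vanishes, then every countable family of `1`-Lipschitz functions
on `X` has the same joint law as some family of `1`-Lipschitz functions on `Y`. -/
lemma exists_lipschitz_map_eq {X Y ι : Type*} [Countable ι]
    [PseudoMetricSpace X] [MeasurableSpace X] [OpensMeasurableSpace X]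
    {mX : Measure X} [IsProbabilityMeasure mX]
    [PseudoMetricSpace Y] [TopologicalSpace.SeparableSpace Y] [MeasurableSpace Y]
    [OpensMeasurableSpace Y] {mY : Measure Y} [IsProbabilityMeasure mY]
    (h : dconc mX mY = 0) {f : ι → X → ℝ} (hf : ∀ i, LipschitzWith 1 (f i)) :
    ∃ G : ι → Y → ℝ, (∀ i, LipschitzWith 1 (G i)) ∧
      mX.map (fun x i => f i x) = mY.map (fun y i => G i y) := by
  obtain ⟨δ, hδpos, hδ4, hδ0⟩ : ∃ δ : ℕ → ℝ≥0,
      (∀ n, 0 < δ n) ∧ (∀ n, δ n ≤ 4⁻¹) ∧ Tendsto δ atTop (𝓝 0) :=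
    -- The shift by 4 gives `δ n ≤ 1/4` from the start, as `exists_abs_le_of_close` requires.
    ⟨fun n => ((n + 4 : ℕ) : ℝ≥0)⁻¹, fun n => by positivity,
      fun n => inv_anti₀ (by norm_num) (by simp),
      (tendsto_add_atTop_iff_nat (f := fun n : ℕ => (n : ℝ≥0)⁻¹) 4).2
        tendsto_inv_atTop_nhds_zero_nat⟩
  have hex : ∀ n, ∃ (φ : UnitIco → X) (ψ : UnitIco → Y) (g : ι → Y → ℝ),
      MeasurePreserving φ lebesgueI mX ∧ MeasurePreserving ψ lebesgueI mY ∧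
      (∀ i, LipschitzWith 1 (g i)) ∧
      ∀ i, lebesgueI {s | (δ n : ℝ) < |f i (φ s) - g i (ψ s)|} ≤ δ n := by
    intro n
    have hlt : dconc mX mY < δ n := h.trans_lt (ENNReal.coe_pos.2 (hδpos n))
    simp only [dconc, iInf_lt_iff] at hlt
    obtain ⟨φ, hφ, ψ, hψ, hH⟩ := hlt
    have hg : ∀ i, ∃ g : Y → ℝ, LipschitzWith 1 g ∧
        kyFan lebesgueI (f i ∘ φ) (g ∘ ψ) < δ n := by
      intro i
      obtain ⟨_, ⟨g, hg, rfl⟩, hlt⟩ :=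
        exists_lt_of_hausdorff_lt hH (mem_image_of_mem (fun f : X → ℝ => f ∘ φ) (hf i))
      exact ⟨g, hg, hlt⟩
    choose g hg hlt using hg
    exact ⟨φ, ψ, g, ⟨hφ.1, hφ.2⟩, ⟨hψ.1, hψ.2⟩, hg, fun i => measure_le_of_kyFan_lt (hlt i)⟩
  choose φ ψ g hφ hψ hg hclose using hex
  have := isProbabilityMeasure_of_measurePreserving (hφ 0)
  obtain ⟨y₀⟩ : Nonempty Y := mY.nonempty_of_neZero
  choose C hC using fun i => exists_abs_le_of_close (P := lebesgueI) (mX := mX) (mY := mY)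
    (hf i).continuous.measurable y₀
  obtain ⟨k, G, hk, hGl, hG⟩ := exists_subseq_tendsto_lipschitz hg y₀
    fun n i => hC i (φ n) (ψ n) (g n i) (δ n) (hφ n) (hψ n) (hg n i) (hδ4 n) (hclose n i)
  exact ⟨G, hGl, map_eq_map_of_close (fun n => hφ (k n)) (fun n => hψ (k n))
    (fun i => (hf i).continuous.measurable) (fun n i => (hg (k n) i).continuous.measurable) hG
    (hδ0.comp hk.tendsto_atTop) fun n i => hclose (k n) i⟩

/-- If the observable distance vanishes, then the support of `mY` is mapped to that of `mX` by a
measure-preserving `1`-Lipschitz map. -/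
lemma exists_lipschitzWith_measurePreserving_of_dconc_eq_zero {X Y : Type*}
    [MetricSpace X] [CompleteSpace X] [SecondCountableTopology X]
    [MeasurableSpace X] [BorelSpace X] {mX : Measure X} [IsProbabilityMeasure mX]
    [MetricSpace Y] [SecondCountableTopology Y]
    [MeasurableSpace Y] [BorelSpace Y] {mY : Measure Y} [IsProbabilityMeasure mY]
    (h : dconc mX mY = 0) :
    ∃ p : mY.support → mX.support, LipschitzWith 1 p ∧
      MeasurePreserving p (onSupport mY) (onSupport mX) := by
  have : Nonempty X := mX.nonempty_of_neZero
  have hx := TopologicalSpace.denseRange_denseSeq X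
  obtain ⟨G, hG, hlaw⟩ := exists_lipschitz_map_eq h
    (f := fun (n : ℕ) a => dist (TopologicalSpace.denseSeq X n) a)
    fun n => LipschitzWith.dist_right _
  exact exists_lipschitzWith_measurePreserving hx hG hlaw

end MMSpace

end

theorem mainTheorem4 {X Y : Type*}
    [MetricSpace X] [CompleteSpace X] [TopologicalSpace.SeparableSpace X]
    [MeasurableSpace X] [BorelSpace X] (mX : Measure X) [IsProbabilityMeasure mX]
    [MetricSpace Y] [CompleteSpace Y] [TopologicalSpace.SeparableSpace Y]
    [MeasurableSpace Y] [BorelSpace Y] (mY : Measure Y) [IsProbabilityMeasure mY]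
    (h : MMSpace.dconc mX mY = 0) :
    MMSpace.MMIsomorphic mX mY := by
  have := UniformSpace.secondCountable_of_separable X
  have := UniformSpace.secondCountable_of_separable Y
  obtain ⟨q, hq, hqm⟩ := MMSpace.exists_lipschitzWith_measurePreserving_of_dconc_eq_zero h
  rw [MMSpace.dconc_comm] at h
  obtain ⟨p, hp, hpm⟩ := MMSpace.exists_lipschitzWith_measurePreserving_of_dconc_eq_zero h
  exact MMSpace.mmIsomorphic_of_lipschitzWith_one hp hpm hq hqm
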